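/- **Theorem (Extremely high-error rate).** Let $(\rho_1,\sigma_1)$ be a pair of density matrices on a finite-dimensional Hilbert space, and let $(\rho_2,\sigma_2)$ be a pair of density matrices on another finite-dimensional Hilbert space with $[\rho_2,\sigma_2]=0$ and $\rho_2\sigma_2\neq 0$ (the latter holds automatically if $\sigma_2$, or $\rho_2$, has full rank). For $n\ge 1$ and $\epsilon\in\mathbb R$ let $R_n^*(\epsilon)\in[0,\infty]$ be the optimal transformation rate, i.e. the supremum of all $R=m/n$ with $m\in\{0,1,2,\dots\}$ for which there is a completely positive trace-preserving map $\mathcal E$ such that $$T\bigl(\mathcal E(\rho_1^{\otimes n}),\rho_2^{\otimes Rn}\bigr)\le\epsilon\qquad\text{and}\qquad \mathcal E(\sigma_1^{\otimes n})=\sigma_2^{\otimes Rn},$$ where $T(\rho,\sigma)=\tfrac12\operatorname{Tr}|\rho-\sigma|$ is the trace distance (the supremum of the empty set being $0$). Then, if the error is allowed to be super-exponentially close to $1$, the optimal rate diverges: for every sequence of real numbers $(f_n)$ with $f_n=\omega(n)$, i.e. $f_n/n\to\infty$, $$\lim_{n\to\infty}R_n^*\bigl(1-\exp(-f_n)\bigr)=\infty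 .$$ -/

import Mathlib

noncomputable section

namespace QuantumDichotomy

open scoped ComplexOrder MatrixOrder Matrix.Norms.L2Operator CStarAlgebra ENNReal

variable {ι κ : Type*} [Fintype ι] [DecidableEq ι] [Fintype κ] [DecidableEq κ]

/-- A (finite-dimensional) quantum state: a positive semidefinite complex matrix of trace one. -/
def IsState (ρ : Matrix ι ι ℂ) : Prop :=
  ρ.PosSemidef ∧ ρ.trace = 1

/-- The `n`-fold tensor power of a matrix, indexed by `n`-tuples of indices:
`⟨i₁ … iₙ| ρ^{⊗ n} |j₁ … jₙ⟩ = ∏ₖ ⟨iₖ| ρ |jₖ⟩`. -/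
def tensorPow (ρ : Matrix ι ι ℂ) (n : ℕ) : Matrix (Fin n → ι) (Fin n → ι) ℂ :=
  Matrix.of fun i j => ∏ k, ρ (i k) (j k)

/-- The trace distance `T(ρ, σ) = (1/2) Tr |ρ - σ|`, where `|X| = √(X* X)`. -/
def traceDist (ρ σ : Matrix ι ι ℂ) : ℝ :=
  (CFC.abs (ρ - σ)).trace.re / 2

/-- A completely positive map between matrix algebras is a quantum channel if it preserves
the trace. -/
def IsTracePreserving (E : Matrix ι ι ℂ →CP Matrix κ κ ℂ) : Prop :=
  ∀ X : Matrix ι ι ℂ, (E X).trace = X.trace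

/-- The approximate Blackwell order `(ρ₁, σ₁) ⪰_{(ερ, εσ)} (ρ₂, σ₂)`: some quantum channel maps
`ρ₁` to within trace distance `ερ` of `ρ₂` and `σ₁` to within trace distance `εσ` of `σ₂`. -/
def ApproxBlackwell (ρ₁ σ₁ : Matrix ι ι ℂ) (ρ₂ σ₂ : Matrix κ κ ℂ) (ερ εσ : ℝ) : Prop :=
  ∃ E : Matrix ι ι ℂ →CP Matrix κ κ ℂ, IsTracePreserving E ∧
    traceDist (E ρ₁) ρ₂ ≤ ερ ∧ traceDist (E σ₁) σ₂ ≤ εσ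

/-- The optimal transformation rate `R_n^*(ε) ∈ [0, ∞]` (for `n ≥ 1`): the supremum of the rates
`R = m / n`, `m ∈ ℕ`, such that
`(ρ₁^{⊗ n}, σ₁^{⊗ n}) ⪰_{(ε, 0)} (ρ₂^{⊗ R n}, σ₂^{⊗ R n})`. -/
def optimalRate (ρ₁ σ₁ : Matrix ι ι ℂ) (ρ₂ σ₂ : Matrix κ κ ℂ) (n : ℕ) (ε : ℝ) : ℝ≥0∞ :=
  ⨆ (m : ℕ) (_ : ApproxBlackwell (tensorPow ρ₁ n) (tensorPow σ₁ n)
    (tensorPow ρ₂ m) (tensorPow σ₂ m) ε 0), (m : ℝ≥0∞) / (n : ℝ≥0∞)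

end QuantumDichotomy

end

noncomputable section

namespace QuantumDichotomy

open scoped ComplexOrder MatrixOrder Matrix.Norms.L2Operator CStarAlgebra ENNReal Matrix

/-! The channel that discards its input and prepares `σ₂^{⊗ m}` is exact on `σ₁^{⊗ n}`, so only the
distance between `σ₂^{⊗ m}` and `ρ₂^{⊗ m}` matters. For commuting states it is at most `1 - Tr(ρ₂^{⊗
m} σ₂^{⊗ m}) = 1 - t ^ m`, where `t = Tr(ρ₂ σ₂) > 0` (`traceDist_le_one_sub_trace_mul`,
`trace_mul_pos`). At any fixed rate `m / n` the overlap `t ^ m` decays only exponentially in `n`, so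
it eventually exceeds `exp (-f n)`. -/

theorem exists_eq_conjTranspose_mul_self {ι : Type*} [Fintype ι] [DecidableEq ι]
    {A : Matrix ι ι ℂ} (hA : A.PosSemidef) : ∃ B : Matrix ι ι ℂ, A = Bᴴ * B :=
  CStarAlgebra.nonneg_iff_eq_star_mul_self.mp (Matrix.nonneg_iff_posSemidef.mpr hA)

section TensorPow

variable {ι : Type*}

theorem conjTranspose_tensorPow (ρ : Matrix ι ι ℂ) (n : ℕ) :
    (tensorPow ρ n)ᴴ = tensorPow ρᴴ n := by
  ext i j
  simp [tensorPow, Matrix.conjTranspose_apply]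

variable [Fintype ι]

theorem tensorPow_mul (ρ σ : Matrix ι ι ℂ) (n : ℕ) :
    tensorPow (ρ * σ) n = tensorPow ρ n * tensorPow σ n := by
  classical
  ext i j
  simp only [tensorPow, Matrix.of_apply, Matrix.mul_apply, ← Finset.prod_mul_distrib]
  rw [Finset.prod_univ_sum, Fintype.piFinset_univ]

theorem trace_tensorPow (ρ : Matrix ι ι ℂ) (n : ℕ) : (tensorPow ρ n).trace = ρ.trace ^ n := by
  classical
  simp only [tensorPow, Matrix.trace, Matrix.diag, Matrix.of_apply]
  rw [← Fintype.piFinset_univ, ← Finset.prod_univ_sum (fun _ => Finset.univ) (fun _ k => ρ k k)]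
  simp

theorem posSemidef_tensorPow [DecidableEq ι] {ρ : Matrix ι ι ℂ} (hρ : ρ.PosSemidef) (n : ℕ) :
    (tensorPow ρ n).PosSemidef := by
  obtain ⟨B, rfl⟩ := exists_eq_conjTranspose_mul_self hρ
  rw [tensorPow_mul, ← conjTranspose_tensorPow]
  exact Matrix.posSemidef_conjTranspose_mul_self _

theorem IsState.tensorPow [DecidableEq ι] {ρ : Matrix ι ι ℂ} (hρ : IsState ρ) (n : ℕ) :
    IsState (tensorPow ρ n) :=
  ⟨posSemidef_tensorPow hρ.1 n, by rw [trace_tensorPow, hρ.2, one_pow]⟩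

theorem commute_tensorPow {ρ σ : Matrix ι ι ℂ} (h : Commute ρ σ) (n : ℕ) :
    Commute (tensorPow ρ n) (tensorPow σ n) := by
  rw [Commute, SemiconjBy, ← tensorPow_mul, h.eq, tensorPow_mul]

end TensorPow

section Trace

variable {ι : Type*} [Fintype ι] [DecidableEq ι]

theorem trace_mul_nonneg {P X : Matrix ι ι ℂ} (hP : P.PosSemidef) (hX : X.PosSemidef) :
    0 ≤ (P * X).trace := by
  obtain ⟨B, rfl⟩ := exists_eq_conjTranspose_mul_self hX
  rw [← mul_assoc, Matrix.trace_mul_comm, ← mul_assoc]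
  exact (hP.mul_mul_conjTranspose_same B).trace_nonneg

theorem continuousOn_spectrum (A : Matrix ι ι ℂ) (g : ℝ → ℝ) :
    ContinuousOn g (spectrum ℝ A) :=
  (Matrix.finite_real_spectrum (A := A)).continuousOn g

/-- With `s` the sign of `X - Y`, `|X - Y| = s (X - Y)`. Since `-1 ≤ s ≤ 1`, the gap between the two
sides is `Tr (1 - s) X + Tr (1 + s) Y ≥ 0`. -/
theorem trace_abs_sub_le {X Y : Matrix ι ι ℂ} (hX : X.PosSemidef) (hY : Y.PosSemidef) :
    (CFC.abs (X - Y)).trace ≤ X.trace + Y.trace := by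
  have hH : IsSelfAdjoint (X - Y) := hX.1.isSelfAdjoint.sub hY.1.isSelfAdjoint
  set s : ℝ → ℝ := fun x => (SignType.sign x : ℝ)
  have hs := continuousOn_spectrum (X - Y) s
  have habs : CFC.abs (X - Y) = cfc s (X - Y) * (X - Y) := by
    conv_rhs => rw [← cfc_id ℝ (X - Y) hH]
    rw [CFC.abs_eq_cfc_norm _ hH, cfc_id ℝ (X - Y) hH]
    nth_rw 3 [← cfc_id ℝ (X - Y) hH]
    rw [← cfc_mul s id (X - Y) hs continuousOn_id]
    refine cfc_congr fun x _ => ?_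
    simp [s, sign_mul_self, Real.norm_eq_abs]
  have hs_le : ∀ x, s x ≤ 1 ∧ -1 ≤ s x := fun x => by
    rcases lt_trichotomy x 0 with h | h | h <;> simp [s, h]
  have h1 : (1 - cfc s (X - Y)).PosSemidef := by
    rw [← Matrix.nonneg_iff_posSemidef, sub_nonneg]
    exact cfc_le_one s _ fun x _ => (hs_le x).1
  have h2 : (1 + cfc s (X - Y)).PosSemidef := by
    rw [← Matrix.nonneg_iff_posSemidef, ← cfc_one ℝ (X - Y) hH,
      ← cfc_add (a := X - Y) 1 s continuousOn_const hs]
    exact cfc_nonneg fun x _ => by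
      have := (hs_le x).2
      simp only [Pi.one_apply]
      linarith
  have e1 := trace_mul_nonneg h1 hX
  have e2 := trace_mul_nonneg h2 hY
  rw [habs, ← sub_nonneg]
  convert add_nonneg e1 e2 using 1
  simp only [sub_mul, add_mul, mul_sub, one_mul, Matrix.trace_sub, Matrix.trace_add]
  ring

theorem IsState.le_one {ρ : Matrix ι ι ℂ} (hρ : IsState ρ) : ρ ≤ 1 := by
  have hsum : ∑ i, hρ.1.1.eigenvalues i = 1 := by
    have h := hρ.2.symm.trans hρ.1.1.trace_eq_sum_eigenvalues
    exact Complex.ofReal_injective (by simpa using h.symm)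
  rw [← map_one (algebraMap ℝ (Matrix ι ι ℂ)),
    le_algebraMap_iff_spectrum_le (R := ℝ) (a := ρ) (ha := hρ.1.1.isSelfAdjoint)]
  intro x hx
  rw [hρ.1.1.spectrum_real_eq_range_eigenvalues] at hx
  obtain ⟨i, rfl⟩ := hx
  rw [← hsum]
  exact Finset.single_le_sum (fun j _ => hρ.1.eigenvalues_nonneg j) (Finset.mem_univ i)

/-- Commuting states `ρ`, `σ` both dominate `ρ σ`, so their overlap is at least `Tr ρ σ`. -/
theorem traceDist_le_one_sub_trace_mul {ρ σ : Matrix ι ι ℂ} (hρ : IsState ρ) (hσ : IsState σ)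
    (h : Commute ρ σ) : traceDist ρ σ ≤ 1 - (ρ * σ).trace.re := by
  have hρ' : (ρ - ρ * σ).PosSemidef := by
    rw [← Matrix.nonneg_iff_posSemidef, ← mul_one_sub]
    exact Commute.mul_nonneg (Matrix.nonneg_iff_posSemidef.mpr hρ.1) (sub_nonneg.mpr hσ.le_one)
      ((Commute.one_right ρ).sub_right h)
  have hσ' : (σ - ρ * σ).PosSemidef := by
    rw [← Matrix.nonneg_iff_posSemidef, ← one_sub_mul]
    exact Commute.mul_nonneg (sub_nonneg.mpr hρ.le_one) (Matrix.nonneg_iff_posSemidef.mpr hσ.1)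
      ((Commute.one_left σ).sub_left h)
  have key := (Complex.le_def.mp (trace_abs_sub_le hρ' hσ')).1
  -- Removing the common part `ρ * σ` from both states leaves their difference unchanged.
  rw [sub_sub_sub_cancel_right] at key
  simp only [Matrix.trace_sub, hρ.2, hσ.2, Complex.add_re, Complex.sub_re, Complex.one_re] at key
  rw [traceDist]
  linarith

theorem traceDist_self (ρ : Matrix ι ι ℂ) : traceDist ρ ρ = 0 := by
  simp [traceDist]

theorem trace_mul_pos {ρ σ : Matrix ι ι ℂ} (hρ : ρ.PosSemidef) (hσ : σ.PosSemidef)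
    (h : Commute ρ σ) (hne : ρ * σ ≠ 0) : 0 < (ρ * σ).trace := by
  have hpos : (ρ * σ).PosSemidef := Matrix.nonneg_iff_posSemidef.mp
    (Commute.mul_nonneg (Matrix.nonneg_iff_posSemidef.mpr hρ)
      (Matrix.nonneg_iff_posSemidef.mpr hσ) h)
  exact lt_of_le_of_ne hpos.trace_nonneg fun h0 => hne (hpos.trace_eq_zero_iff.mp h0.symm)

end Trace

section Replacement

variable {ι κ : Type*} [Fintype ι] [Fintype κ] [DecidableEq κ]

/-- Complete positivity of the replacement map: `Tr (x* y)` is the sum over entries `(a, b)` of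
`conj (x a b) * y a b`, so a square is sent to a sum of squares. -/
theorem map_trace_smulRight_star_mul_self {k : Type*} [Fintype k] (T : Matrix κ κ ℂ)
    (N : CStarMatrix k k (Matrix ι ι ℂ)) :
    (star N * N).map ((Matrix.traceLinearMap ι ℂ ℂ).smulRight (Tᴴ * T)) =
      ∑ b, ∑ a, star (CStarMatrix.ofMatrix (Matrix.of fun l j => N l j a b • T)) *
        CStarMatrix.ofMatrix (Matrix.of fun l j => N l j a b • T) := by
  have hsum : ∀ (F : ι → ι → CStarMatrix k k (Matrix κ κ ℂ)) (i j : k),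
      (∑ b, ∑ a, F a b) i j = ∑ b, ∑ a, F a b i j := fun F i j => by
    let ev : CStarMatrix k k (Matrix κ κ ℂ) →+ Matrix κ κ ℂ :=
      { toFun := fun A => A i j, map_zero' := rfl, map_add' := fun _ _ => rfl }
    exact (map_sum ev _ _).trans (Finset.sum_congr rfl fun b _ => map_sum ev _ _)
  ext i j : 1
  rw [hsum, CStarMatrix.map_apply, LinearMap.smulRight_apply, Matrix.traceLinearMap_apply]
  simp only [CStarMatrix.mul_apply, CStarMatrix.star_apply, CStarMatrix.ofMatrix_apply,
    Matrix.of_apply, star_smul, smul_mul_smul_comm, Matrix.trace_sum, ← Finset.sum_smul,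
    Matrix.star_eq_conjTranspose]
  congr 1
  simp only [Matrix.trace, Matrix.diag, Matrix.mul_apply, Matrix.conjTranspose_apply]
  rw [Finset.sum_comm]
  exact Finset.sum_congr rfl fun b _ => Finset.sum_comm

variable [DecidableEq ι]

/-- The map that discards its input and prepares `S`. -/
def replacementMap (S : Matrix κ κ ℂ) (hS : S.PosSemidef) :
    Matrix ι ι ℂ →CP Matrix κ κ ℂ where
  toLinearMap := (Matrix.traceLinearMap ι ℂ ℂ).smulRight S
  map_cstarMatrix_nonneg' k M hM := by
    obtain ⟨T, rfl⟩ := exists_eq_conjTranspose_mul_self hS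
    rw [StarOrderedRing.nonneg_iff] at hM
    induction hM using AddSubmonoid.closure_induction with
    | mem _ h =>
      obtain ⟨N, rfl⟩ := h
      dsimp only
      rw [map_trace_smulRight_star_mul_self]
      exact Finset.sum_nonneg fun b _ => Finset.sum_nonneg fun a _ => star_mul_self_nonneg _
    | zero => exact le_of_eq (by ext i j : 2; simp)
    | add A B _ _ hA hB => exact (add_nonneg hA hB).trans_eq (by ext i j : 2; simp [add_mul])

theorem replacementMap_apply (S : Matrix κ κ ℂ) (hS : S.PosSemidef) (X : Matrix ι ι ℂ) :
    replacementMap S hS X = X.trace • S := rfl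

theorem isTracePreserving_replacementMap {S : Matrix κ κ ℂ} (hS : IsState S) :
    IsTracePreserving (replacementMap (ι := ι) S hS.1) := fun X => by
  rw [replacementMap_apply, Matrix.trace_smul, hS.2, smul_eq_mul, mul_one]

theorem approxBlackwell_of_traceDist_le {ρ₁ σ₁ : Matrix ι ι ℂ} {ρ₂ σ₂ : Matrix κ κ ℂ} {ε : ℝ}
    (hρ₁ : IsState ρ₁) (hσ₁ : IsState σ₁) (hσ₂ : IsState σ₂) (h : traceDist σ₂ ρ₂ ≤ ε) :
    ApproxBlackwell ρ₁ σ₁ ρ₂ σ₂ ε 0 := by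
  refine ⟨replacementMap σ₂ hσ₂.1, isTracePreserving_replacementMap hσ₂, ?_, ?_⟩
  · rwa [replacementMap_apply, hρ₁.2, one_smul]
  · rw [replacementMap_apply, hσ₁.2, one_smul, traceDist_self]

theorem le_optimalRate {ρ₁ σ₁ : Matrix ι ι ℂ} {ρ₂ σ₂ : Matrix κ κ ℂ}
    (hρ₁ : IsState ρ₁) (hσ₁ : IsState σ₁) (hρ₂ : IsState ρ₂) (hσ₂ : IsState σ₂)
    (hcomm : Commute ρ₂ σ₂) {m n : ℕ} {ε : ℝ} (h : 1 - (ρ₂ * σ₂).trace.re ^ m ≤ ε) :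
    (m : ℝ≥0∞) / n ≤ optimalRate ρ₁ σ₁ ρ₂ σ₂ n ε := by
  refine le_iSup₂_of_le m (approxBlackwell_of_traceDist_le (hρ₁.tensorPow n) (hσ₁.tensorPow n)
    (hσ₂.tensorPow m) ?_) le_rfl
  refine (traceDist_le_one_sub_trace_mul (hσ₂.tensorPow m) (hρ₂.tensorPow m)
    (commute_tensorPow hcomm.symm m)).trans (le_trans (le_of_eq ?_) h)
  -- The trace is real, so taking real parts commutes with the `m`-th power.
  have him : (ρ₂ * σ₂).trace = ((ρ₂ * σ₂).trace.re : ℂ) :=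
    Complex.ext rfl (by simpa using (Complex.le_def.mp (trace_mul_nonneg hρ₂.1 hσ₂.1)).2.symm)
  rw [← tensorPow_mul, trace_tensorPow, ← hcomm.eq, him, ← Complex.ofReal_pow, Complex.ofReal_re,
    Complex.ofReal_re]

end Replacement

end QuantumDichotomy

end

theorem mainTheorem7 {ι κ : Type*} [Fintype ι] [DecidableEq ι] [Fintype κ] [DecidableEq κ]
    (ρ₁ σ₁ : Matrix ι ι ℂ) (ρ₂ σ₂ : Matrix κ κ ℂ)
    (hρ₁ : QuantumDichotomy.IsState ρ₁) (hσ₁ : QuantumDichotomy.IsState σ₁)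
    (hρ₂ : QuantumDichotomy.IsState ρ₂) (hσ₂ : QuantumDichotomy.IsState σ₂)
    (hcomm : Commute ρ₂ σ₂) (hne : ρ₂ * σ₂ ≠ 0)
    (f : ℕ → ℝ)
    (hf : Filter.Tendsto (fun n : ℕ => f n / (n : ℝ)) Filter.atTop Filter.atTop) :
    Filter.Tendsto
      (fun n : ℕ => QuantumDichotomy.optimalRate ρ₁ σ₁ ρ₂ σ₂ n (1 - Real.exp (-f n)))
      Filter.atTop (nhds (⊤ : ENNReal)) := by
  have ht : 0 < (ρ₂ * σ₂).trace.re :=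
    (Complex.lt_def.mp (QuantumDichotomy.trace_mul_pos hρ₂.1 hσ₂.1 hcomm hne)).1
  set t := (ρ₂ * σ₂).trace.re
  rw [ENNReal.tendsto_nhds_top_iff_nat]
  intro M
  filter_upwards [hf.eventually_ge_atTop ((M + 1) * -Real.log t), Filter.eventually_ge_atTop 1]
    with n hn hn1
  have hn0 : (0 : ℝ) < n := by exact_mod_cast hn1
  -- Taking `m = (M + 1) * n` gives rate `M + 1`, strictly above `M`.
  have hrate : (((M + 1) * n : ℕ) : ENNReal) / n = ((M + 1 : ℕ) : ENNReal) := by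
    rw [Nat.cast_mul, ENNReal.mul_div_cancel_right (by exact_mod_cast hn0.ne')
      (ENNReal.natCast_ne_top n)]
  have hlt : (M : ENNReal) < ((M + 1 : ℕ) : ENNReal) := by exact_mod_cast M.lt_succ_self
  refine (hlt.trans_eq hrate.symm).trans_le
    (QuantumDichotomy.le_optimalRate hρ₁ hσ₁ hρ₂ hσ₂ hcomm (sub_le_sub_left ?_ 1))
  -- On logarithms the claim is `-f n ≤ (M + 1) * n * log t`, which is `hn` multiplied by `n`.
  rw [← Real.exp_log (pow_pos ht _), Real.exp_le_exp, Real.log_pow]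
  rw [le_div_iff₀ hn0] at hn
  push_cast
  linarith
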